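/- Let $\lambda$ be an infinite successor cardinal (that is, $\lambda=\nu^+$ for some infinite cardinal $\nu$), and let $E^{\lambda^+}_\lambda:=\{\delta<\lambda^+\mid \operatorname{cf}(\delta)=\lambda\}$. Then there exists a sequence $\langle C_\delta\mid\delta\in E^{\lambda^+}_\lambda\rangle$ such that: (i) for every $\delta\in E^{\lambda^+}_\lambda$, $C_\delta$ is a closed subset of $\delta$ with $\sup(C_\delta)=\sup(\delta)=\delta$, and the order type of $C_\delta$ is at most $\lambda$ (that is, the sequence is a $\lambda$-bounded $C$-sequence); (ii) for every club $D\subseteq\lambda^+$, there is a $\delta\in E^{\lambda^+}_\lambda$ such that the set $$\{\beta<\delta\mid \min(C_\delta\setminus(\beta+1))\in D\cap E^{\lambda^+}_\lambda\}$$ is stationary in $\delta$. -/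

import Mathlib

open Cardinal Ordinal

universe u

/-- `cofPoints κ θ` is the set `E^κ_θ = {α < κ | cf(α) = θ}`. -/
def cofPoints (κ θ : Cardinal.{u}) : Set Ordinal.{u} :=
  {α | α < κ.ord ∧ α.cof = θ}

/-- The trace of a set of ordinals `A` on `δ`, as a subset of the well-order `{β | β < δ}`. -/
def traceOn (A : Set Ordinal.{u}) (δ : Ordinal.{u}) : Set (Set.Iio δ) :=
  Subtype.val ⁻¹' A

/-- `D` is a club in `δ`: a closed and unbounded subset of `δ`. -/
def IsClubIn (D : Set Ordinal.{u}) (δ : Ordinal.{u}) : Prop :=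
  D ⊆ Set.Iio δ ∧ IsClub (traceOn D δ)

/-- `A` is a stationary subset of `δ`: it is a subset of `δ` that meets every club in `δ`. -/
def IsStationaryIn (A : Set Ordinal.{u}) (δ : Ordinal.{u}) : Prop :=
  A ⊆ Set.Iio δ ∧ IsStationary (traceOn A δ)

/-- `C` is a `C`-sequence over `S`: for every `δ ∈ S`, the set `C δ` is a closed subset of `δ`
with `sup (C δ) = sup δ`. The values of `C` outside `S` play no role. -/
structure IsCSequence (S : Set Ordinal.{u}) (C : Ordinal.{u} → Set Ordinal.{u}) : Prop where
  subset : ∀ δ ∈ S, C δ ⊆ Set.Iio δ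
  closed : ∀ δ ∈ S, DirSupClosed (traceOn (C δ) δ)
  sup_eq : ∀ δ ∈ S, sSup (C δ) = sSup (Set.Iio δ)

/-- The sequence `C` over `S` is `ξ`-bounded: `otp (C δ) ≤ ξ` for every `δ ∈ S`. The lift only
adjusts the universe, since a set of ordinals lives one universe higher. -/
def IsBoundedSeq (ξ : Ordinal.{u}) (S : Set Ordinal.{u})
    (C : Ordinal.{u} → Set Ordinal.{u}) : Prop :=
  ∀ δ ∈ S, typeLT (C δ) ≤ Ordinal.lift.{u + 1} ξ

/-- `min (A \ (β + 1))`, the next point of `A` above `β`. -/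
noncomputable def nextPoint (A : Set Ordinal.{u}) (β : Ordinal.{u}) : Ordinal.{u} :=
  sInf (A \ Set.Iio (β + 1))

/-! Write `κ` for the successor of `lam` and `S` for the points below `κ` of cofinality `lam`. The
proof guesses by intervals, sharpens these to points, and reads the points off as next points of a
club.

Intervals (`exists_interval_guessing`): if every choice of clubs failed, it could be shrunk `ω`
times, the gaps at each stage missing a new club `D n`. Fix `x ∈ S` in all the `D n`, below a
suitable `δ`. The last points of the shrinking clubs up to `x` decrease, hence stabilise, and the
gap after the stable value then contains `x`.

Points (`exists_point_guessing`): if no function guesses, then for any `ν` functions one club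
defeats them all. Starting from the interval endpoints, close `ω` times under dropping to the last
point of that club and under a fixed cofinal set of each ordinal of cofinality at most `ν`. A least
value that still has a guessed point in its interval lies in the club, and minimality forces its
cofinality to be `lam`. Since `lam` is the successor of `ν`, smaller cofinalities are at most `ν`,
so `ν` functions suffice. -/

/-! ### Clubs and stationary sets in terms of ordinals -/

theorem dirSupClosed_traceOn_iff {D : Set Ordinal.{u}} {δ : Ordinal.{u}} :
    DirSupClosed (traceOn D δ) ↔ ∀ a < δ, (∃ c ∈ D, c ≤ a) →
      (∀ b < a, ∃ c ∈ D, b < c ∧ c ≤ a) → a ∈ D := by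
  rw [dirSupClosed_iff_of_linearOrder]
  constructor
  · intro h a ha ⟨c, hc, hca⟩ hb
    refine h (d := {x | x.1 ∈ D ∧ x.1 ≤ a}) (fun x hx ↦ hx.1)
      ⟨⟨c, hca.trans_lt ha⟩, hc, hca⟩ (a := ⟨a, ha⟩) ⟨fun x hx ↦ hx.2, fun y hy ↦ ?_⟩
    by_contra! hlt
    obtain ⟨d, hd, hyd, hda⟩ := hb y.1 hlt
    exact hyd.not_ge (hy (a := ⟨d, hda.trans_lt ha⟩) ⟨hd, hda⟩)
  · intro h d hd hne a ha
    obtain ⟨x, hx⟩ := hne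
    refine h a.1 a.2 ⟨x, hd hx, ha.1 hx⟩ fun b hb ↦ ?_
    obtain ⟨y, hy, hby⟩ := (lt_isLUB_iff (b := (⟨b, hb.trans a.2⟩ : Set.Iio δ)) ha).1 hb
    exact ⟨y, hd hy, hby, ha.1 hy⟩

theorem isCofinal_traceOn_iff {D : Set Ordinal.{u}} {δ : Ordinal.{u}} (hD : D ⊆ Set.Iio δ) :
    IsCofinal (traceOn D δ) ↔ ∀ a < δ, ∃ b ∈ D, a ≤ b :=
  ⟨fun h a ha ↦ let ⟨b, hb, hab⟩ := h ⟨a, ha⟩; ⟨b, hb, hab⟩,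
    fun h a ↦ let ⟨b, hb, hab⟩ := h a.1 a.2; ⟨⟨b, hD hb⟩, hb, hab⟩⟩

theorem isClubIn_iff {D : Set Ordinal.{u}} {δ : Ordinal.{u}} :
    IsClubIn D δ ↔ D ⊆ Set.Iio δ ∧ (∀ a < δ, (∃ c ∈ D, c ≤ a) →
      (∀ b < a, ∃ c ∈ D, b < c ∧ c ≤ a) → a ∈ D) ∧ ∀ a < δ, ∃ b ∈ D, a ≤ b := by
  rw [IsClubIn, isClub_iff, dirSupClosed_traceOn_iff]
  exact and_congr_right fun h ↦ and_congr_right fun _ ↦ isCofinal_traceOn_iff h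

theorem aleph0_lt_cof_Iio {δ : Ordinal.{u}} (hδ : ℵ₀ < δ.cof) : ℵ₀ < Order.cof (Set.Iio δ) := by
  rw [cof_Iio, ← lift_cof]
  exact aleph0_lt_lift.2 hδ

theorem IsClubIn.forall_mem {ι : Type u} {E : ι → Set Ordinal.{u}} {δ : Ordinal.{u}}
    (hδ : ℵ₀ < δ.cof) (hι : #ι < δ.cof) (h : ∀ i, IsClubIn (E i) δ) :
    IsClubIn {β | β < δ ∧ ∀ i, β ∈ E i} δ := by
  refine ⟨fun β hβ ↦ hβ.1, ?_⟩
  have : traceOn {β | β < δ ∧ ∀ i, β ∈ E i} δ = ⋂ i, traceOn (E i) δ := by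
    ext ⟨x, hx⟩
    simp only [Set.mem_iInter, traceOn, Set.mem_preimage, Set.mem_ofPred_eq]
    exact ⟨fun h ↦ h.2, fun h ↦ ⟨hx, h⟩⟩
  rw [this]
  refine IsClub.iInter (aleph0_lt_cof_Iio hδ).ne' ?_ fun i ↦ (h i).2
  rw [cof_Iio, ← lift_cof, Cardinal.lift_lift]
  exact Cardinal.lift_lt.2 hι

theorem IsClubIn.forall_nat_mem {E : ℕ → Set Ordinal.{u}} {δ : Ordinal.{u}}
    (hδ : ℵ₀ < δ.cof) (h : ∀ i, IsClubIn (E i) δ) :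
    IsClubIn {β | β < δ ∧ ∀ i, β ∈ E i} δ := by
  have := IsClubIn.forall_mem (ι := ULift.{u} ℕ) (E := fun i ↦ E i.down) hδ (by simpa using hδ)
    fun i ↦ h i.down
  simpa using this

theorem IsClubIn.inter {E F : Set Ordinal.{u}} {δ : Ordinal.{u}}
    (hδ : ℵ₀ < δ.cof) (hE : IsClubIn E δ) (hF : IsClubIn F δ) : IsClubIn (E ∩ F) δ :=
  ⟨fun _ h ↦ hE.1 h.1, hE.2.inter (aleph0_lt_cof_Iio hδ).ne' hF.2⟩

theorem IsStationaryIn.exists_mem {A E : Set Ordinal.{u}} {δ : Ordinal.{u}}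
    (hA : IsStationaryIn A δ) (hE : IsClubIn E δ) : ∃ β ∈ A, β ∈ E :=
  let ⟨x, hx, hx'⟩ := hA.2 hE.2
  ⟨x, hx, hx'⟩

theorem exists_isClubIn_of_not_isStationaryIn {A : Set Ordinal.{u}} {δ : Ordinal.{u}}
    (hA : A ⊆ Set.Iio δ) (h : ¬ IsStationaryIn A δ) : ∃ E, IsClubIn E δ ∧ ∀ β ∈ E, β ∉ A := by
  have h' : ¬ IsStationary (traceOn A δ) := fun h' ↦ h ⟨hA, h'⟩
  obtain ⟨t, ht, hd⟩ := not_isStationary_iff.1 h'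
  refine ⟨Subtype.val '' t, ⟨by rintro _ ⟨x, -, rfl⟩; exact x.2, ?_⟩, ?_⟩
  · rwa [traceOn, Set.preimage_image_eq _ Subtype.val_injective]
  · rintro _ ⟨x, hx, rfl⟩ hxA
    exact Set.disjoint_left.1 hd hxA hx

theorem isStationaryIn_of_forall {A : Set Ordinal.{u}} {δ : Ordinal.{u}} (hA : A ⊆ Set.Iio δ)
    (h : ∀ E, IsClubIn E δ → ∃ β ∈ A, β ∈ E) : IsStationaryIn A δ := by
  by_contra hn
  obtain ⟨E, hE, hEA⟩ := exists_isClubIn_of_not_isStationaryIn hA hn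
  obtain ⟨β, hβ, hβE⟩ := h E hE
  exact hEA β hβE hβ

theorem isSuccLimit_of_aleph0_lt_cof {δ : Ordinal.{u}} (hδ : ℵ₀ < δ.cof) : Order.IsSuccLimit δ :=
  one_lt_cof_iff.1 (one_lt_aleph0.trans hδ)

theorem IsClubIn.exists_gt {D : Set Ordinal.{u}} {δ : Ordinal.{u}} (hδ : ℵ₀ < δ.cof)
    (hD : IsClubIn D δ) {a : Ordinal.{u}} (ha : a < δ) : ∃ b ∈ D, a < b :=
  let ⟨b, hb, hab⟩ := (isClubIn_iff.1 hD).2.2 _ ((isSuccLimit_of_aleph0_lt_cof hδ).succ_lt ha)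
  ⟨b, hb, Order.succ_le_iff.1 hab⟩

/-- A closed set contains the largest of its points up to `a`, computed as a supremum. -/
theorem IsClubIn.sSup_mem {D : Set Ordinal.{u}} {δ a c : Ordinal.{u}} (hD : IsClubIn D δ)
    (ha : a < δ) (hc : c ∈ D) (hca : c ≤ a) : sSup (D ∩ Set.Iic a) ∈ D := by
  have hne : (D ∩ Set.Iic a).Nonempty := ⟨c, hc, hca⟩
  have hbd : BddAbove (D ∩ Set.Iic a) := ⟨a, fun x hx ↦ hx.2⟩
  refine (isClubIn_iff.1 hD).2.1 _ ((csSup_le hne fun x hx ↦ hx.2).trans_lt ha)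
    ⟨c, hc, le_csSup hbd ⟨hc, hca⟩⟩ fun b hb ↦ ?_
  obtain ⟨x, hx, hbx⟩ := exists_lt_of_lt_csSup hne hb
  exact ⟨x, hx.1, hbx, le_csSup hbd hx⟩

/-! ### Closing-off arguments -/

/-- The supremum of the iterates of `g` at `a₀` stays below `δ`, whose cofinality is uncountable. -/
theorem exists_lt_closed_under {δ : Ordinal.{u}} (hδ : ℵ₀ < δ.cof) {g : Ordinal.{u} → Ordinal.{u}}
    (hg : ∀ b < δ, b < g b ∧ g b < δ) {a₀ : Ordinal.{u}} (h₀ : a₀ < δ) :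
    ∃ a, a₀ < a ∧ a < δ ∧ ∀ b < a, ∃ c, b < c ∧ c < g c ∧ g c < a := by
  have hlt : ∀ k, g^[k] a₀ < δ := fun k ↦ by
    induction k with
    | zero => exact h₀
    | succ k ih => rw [Function.iterate_succ_apply']; exact (hg _ ih).2
  have hstep : ∀ k, g^[k] a₀ < g^[k + 1] a₀ := fun k ↦ by
    rw [Function.iterate_succ_apply']; exact (hg _ (hlt k)).1
  have hle : ∀ k, g^[k] a₀ ≤ ⨆ n, g^[n] a₀ := fun k ↦ Ordinal.le_iSup (fun n ↦ g^[n] a₀) k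
  refine ⟨⨆ k, g^[k] a₀, (hstep 0).trans_le (hle 1), ?_, fun b hb ↦ ?_⟩
  · refine lift_iSup_lt_of_lt_cof ?_ hlt
    simpa using hδ
  · obtain ⟨k, hk⟩ := (Ordinal.lt_iSup_iff).1 hb
    have h1 := Function.iterate_succ_apply' g k a₀
    exact ⟨g^[k] a₀, hk, h1 ▸ hstep k, h1 ▸ (hstep (k + 1)).trans_le (hle (k + 2))⟩

theorem isClubIn_limitPoints {A : Set Ordinal.{u}} {δ : Ordinal.{u}} (hδ : ℵ₀ < δ.cof)
    (hA : ∀ a < δ, ∃ b ∈ A, a < b ∧ b < δ) :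
    IsClubIn {a | a < δ ∧ ∀ b < a, ∃ c ∈ A, b < c ∧ c < a} δ := by
  refine isClubIn_iff.2 ⟨fun a h ↦ h.1, fun a ha _ h ↦ ⟨ha, fun b hb ↦ ?_⟩, fun a ha ↦ ?_⟩
  · obtain ⟨c, hc, hbc, hca⟩ := h b hb
    obtain ⟨d, hd, hbd, hdc⟩ := hc.2 b hbc
    exact ⟨d, hd, hbd, hdc.trans_le hca⟩
  · choose! g hg using hA
    obtain ⟨x, hax, hxδ, hx⟩ := exists_lt_closed_under hδ (fun b hb ↦ (hg b hb).2) ha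
    refine ⟨x, ⟨hxδ, fun b hb ↦ ?_⟩, hax.le⟩
    obtain ⟨c, hbc, hcg, hgx⟩ := hx b hb
    exact ⟨g c, (hg c (hcg.trans (hgx.trans hxδ))).1, hbc.trans hcg, hgx⟩

/-- Every initial segment of `B` has fewer than `lam` elements. -/
def HasSmallSegments (lam : Cardinal.{u}) (B : Set Ordinal.{u}) (δ : Ordinal.{u}) : Prop :=
  ∀ b < δ, #↥(B ∩ Set.Iio b) < Cardinal.lift.{u + 1} lam

theorem isClubIn_closurePoints {lam : Cardinal.{u}} {B : Set Ordinal.{u}} {δ : Ordinal.{u}}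
    (hlam : ℵ₀ < lam) (hδ : δ.cof = lam) (hB : IsClubIn B δ) (hs : HasSmallSegments lam B δ)
    {f : Ordinal.{u} → Ordinal.{u}} (hf : ∀ b < δ, f b < δ) :
    IsClubIn {a | a ∈ B ∧ ∀ b ∈ B, b < a → f b < a} δ := by
  have hδ' : ℵ₀ < δ.cof := hδ ▸ hlam
  have hlim := isSuccLimit_of_aleph0_lt_cof hδ'
  refine isClubIn_iff.2 ⟨fun a h ↦ hB.1 h.1, fun a ha ⟨c, hc, hca⟩ h ↦ ⟨?_, fun b hb hba ↦ ?_⟩,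
    fun a ha ↦ ?_⟩
  · refine (isClubIn_iff.1 hB).2.1 a ha ⟨c, hc.1, hca⟩ fun b hb ↦ ?_
    obtain ⟨c, hc, h'⟩ := h b hb
    exact ⟨c, hc.1, h'⟩
  · obtain ⟨c, hc, hbc, hca⟩ := h b hba
    exact (hc.2 b hb hbc).trans_le hca
  · have key : ∀ a < δ, ∃ b ∈ B, (a < b ∧ b < δ) ∧ ∀ c ∈ B, c ≤ a → f c < b := fun a ha ↦ by
      have hsm : sSup (f '' (B ∩ Set.Iio (Order.succ a))) < δ := by
        refine sSup_lt_of_lt_cof (mk_image_le.trans_lt ?_) ?_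
        · rw [← lift_cof, hδ]
          exact hs _ (hlim.succ_lt ha)
        · rintro _ ⟨x, hx, rfl⟩
          exact hf x (hB.1 hx.1)
      obtain ⟨b, hb, hlt⟩ := hB.exists_gt hδ' (max_lt ha hsm)
      refine ⟨b, hb, ⟨(le_max_left _ _).trans_lt hlt, hB.1 hb⟩, fun c hc hca ↦ ?_⟩
      refine lt_of_le_of_lt (le_csSup (s := f '' (B ∩ Set.Iio (Order.succ a))) ⟨δ, ?_⟩
        ⟨c, ⟨hc, Order.lt_succ_iff.2 hca⟩, rfl⟩)
        ((le_max_right _ _).trans_lt hlt)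
      rintro _ ⟨x, hx, rfl⟩
      exact (hf x (hB.1 hx.1)).le
    choose! g hg using key
    obtain ⟨x, hax, hxδ, hx⟩ := exists_lt_closed_under hδ' (fun b hb ↦ (hg b hb).2.1) ha
    have hgd : ∀ c, c < g c → g c < x → c < δ := fun c h h' ↦ h.trans (h'.trans hxδ)
    refine ⟨x, ⟨?_, fun b hb hbx ↦ ?_⟩, hax.le⟩
    · refine (isClubIn_iff.1 hB).2.1 x hxδ ?_ fun b hb ↦ ?_
      · obtain ⟨c, -, hcg, hgx⟩ := hx a hax
        exact ⟨g c, (hg c (hgd c hcg hgx)).1, hgx.le⟩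
      · obtain ⟨c, hbc, hcg, hgx⟩ := hx b hb
        exact ⟨g c, (hg c (hgd c hcg hgx)).1, hbc.trans hcg, hgx.le⟩
    · obtain ⟨c, hbc, hcg, hgx⟩ := hx b hbx
      exact ((hg c (hgd c hcg hgx)).2.2 b hb hbc.le).trans hgx

/-! ### Thin clubs and points of cofinality `lam` -/

/-- Make a fundamental sequence continuous: its `j`-th point `h j` then has the cofinality of `j`,
which is below `lam`. -/
theorem exists_isClubIn_smallSegments {lam : Cardinal.{u}} {δ : Ordinal.{u}}
    (hlam : ℵ₀ < lam) (hδ : δ.cof = lam) :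
    ∃ B, IsClubIn B δ ∧ HasSmallSegments lam B δ ∧ ∀ b ∈ B, b.cof ≠ lam := by
  obtain ⟨f, hf⟩ := exists_isFundamentalSeq (o := δ) (congrArg Cardinal.ord hδ)
  have hlim := isSuccLimit_ord hlam.le
  let F : Ordinal.{u} → Ordinal.{u} := fun i ↦ if h : i < lam.ord then f ⟨i, h⟩ else 0
  have hF : ∀ i (h : i < lam.ord), F i = f ⟨i, h⟩ := fun i h ↦ dif_pos h
  have hFδ : ∀ i < lam.ord, F i < δ := fun i h ↦ by rw [hF i h]; exact (f _).2
  have hFm : ∀ i j, i < j → j < lam.ord → F i < F j := fun i j h hj ↦ by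
    rw [hF i (h.trans hj), hF j hj]
    exact hf.strictMono (show (⟨i, h.trans hj⟩ : Set.Iio lam.ord) < ⟨j, hj⟩ from h)
  have hFc : ∀ b < δ, ∃ j < lam.ord, b ≤ F j := fun b hb ↦ by
    obtain ⟨_, ⟨j, rfl⟩, (hj : b ≤ f j)⟩ := hf.isCofinal_range ⟨b, hb⟩
    exact ⟨j, j.2, (hF j j.2).symm ▸ hj⟩
  let h : Ordinal.{u} → Ordinal.{u} := fun j ↦ ⨆ i : Set.Iio j, (F i + 1)
  have hlt : ∀ i j, i < j → F i < h j := fun i j hij ↦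
    Order.add_one_le_iff.1 (Ordinal.le_iSup (fun i : Set.Iio j ↦ F i + 1) ⟨i, hij⟩)
  have hle : ∀ j < lam.ord, h j ≤ F j := fun j hj ↦
    Ordinal.iSup_le_iff.2 fun i ↦ Order.add_one_le_iff.2 (hFm _ _ i.2 hj)
  have hmono : ∀ i j, i ≤ j → h i ≤ h j := fun i j hij ↦
    Ordinal.iSup_le_iff.2 fun k ↦ Order.add_one_le_iff.2 (hlt _ _ (k.2.trans_le hij))
  refine ⟨h '' Set.Iio lam.ord, isClubIn_iff.2 ⟨?_, fun a ha _ hP ↦ ?_, fun a ha ↦ ?_⟩,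
    fun b hb ↦ ?_, ?_⟩
  · rintro _ ⟨j, hj, rfl⟩
    exact (hle j hj).trans_lt (hFδ j hj)
  · have hex : ∃ j, j < lam.ord ∧ a ≤ h j := by
      obtain ⟨j, hj, haj⟩ := hFc a ha
      exact ⟨_, hlim.succ_lt hj, haj.trans (hlt _ _ (Order.lt_succ j)).le⟩
    obtain ⟨j, ⟨hj, haj⟩, hmin⟩ : ∃ j, (j < lam.ord ∧ a ≤ h j) ∧
        ∀ i < j, ¬ (i < lam.ord ∧ a ≤ h i) :=
      ⟨_, csInf_mem (s := {j | j < lam.ord ∧ a ≤ h j}) hex, fun i hi ↦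
        notMem_of_lt_csInf' (s := {j | j < lam.ord ∧ a ≤ h j}) hi⟩
    obtain rfl | haj := haj.eq_or_lt
    · exact ⟨j, hj, rfl⟩
    -- Otherwise `h i < a ≤ F i` for some `i < j`, but every value of `h` past `h i` exceeds `F i`.
    obtain ⟨⟨i, hi⟩, hai⟩ := Ordinal.lt_iSup_iff.1 haj
    have hia : h i < a := by
      by_contra! hge
      exact hmin i hi ⟨lt_trans hi hj, hge⟩
    obtain ⟨_, ⟨k, hk, rfl⟩, hik, hka⟩ := hP _ hia
    have hik' : i < k := lt_of_not_ge fun hki ↦ (hmono _ _ hki).not_gt hik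
    exact absurd (hlt i k hik') (not_lt.2 (hka.trans (Order.lt_add_one_iff.1 hai)))
  · obtain ⟨j, hj, haj⟩ := hFc a ha
    exact ⟨_, ⟨_, hlim.succ_lt hj, rfl⟩, haj.trans (hlt _ _ (Order.lt_succ j)).le⟩
  · obtain ⟨j, hj, hbj⟩ := hFc b hb
    have hsub : h '' Set.Iio lam.ord ∩ Set.Iio b ⊆ h '' Set.Iio (Order.succ j) := by
      rintro _ ⟨⟨k, hk, rfl⟩, hkb⟩
      refine ⟨k, Set.mem_Iio.2 (lt_of_not_ge fun hjk ↦ ?_), rfl⟩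
      exact (hbj.trans_lt (hlt j k (Order.succ_le_iff.1 hjk))).not_gt hkb
    refine (mk_le_mk_of_subset hsub).trans_lt (mk_image_le.trans_lt ?_)
    rw [Cardinal.mk_Iio_ordinal, Cardinal.lift_lt]
    exact lt_ord.1 (hlim.succ_lt hj)
  · rintro _ ⟨j, hj, rfl⟩
    have : StrictMono (fun i : Set.Iio j ↦ F i) := fun x y hxy ↦
      hFm _ _ hxy (lt_trans y.2 hj)
    rw [show (h j).cof = j.cof from cof_iSup_Iio_add_one this]
    exact ((cof_le_card j).trans_lt (lt_ord.1 hj)).ne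

theorem exists_mem_cofPoints {lam : Cardinal.{u}} (hlam : lam.IsRegular)
    {D : Set Ordinal.{u}} (hD : IsClubIn D (Order.succ lam).ord) {a : Ordinal.{u}}
    (ha : a < (Order.succ lam).ord) :
    ∃ b ∈ D ∩ cofPoints (Order.succ lam) lam, a < b := by
  have hκ := isRegular_succ hlam.aleph0_le
  set κ := (Order.succ lam).ord with hκdef
  have hcof : κ.cof = Order.succ lam := hκ.cof_ord
  have hκ0 : ℵ₀ < κ.cof := hcof ▸ hlam.aleph0_le.trans_lt (Order.lt_succ lam)
  -- The tail from `κ` on only makes `s` unbounded, as `enumOrd` needs. The first `κ` values stay in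
  -- `D`, and the supremum of the first `lam` has cofinality `lam`.
  let s : Set Ordinal.{u} := (D ∩ Set.Ioi a) ∪ Set.Ici κ
  have hsu : ¬ BddAbove s := by
    rintro ⟨b, hb⟩
    have := hb (a := Order.succ (max b κ)) (Or.inr ((le_max_right b κ).trans (Order.le_succ _)))
    exact ((le_max_left b κ).trans_lt (Order.lt_succ _)).not_ge this
  have hsup : ∀ o < κ, (∀ i < o, enumOrd s i < κ) → ⨆ i : Set.Iio o, enumOrd s i < κ := by
    intro o ho h
    refine lift_iSup_lt_of_lt_cof ?_ fun i ↦ h i i.2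
    rw [Cardinal.mk_Iio_ordinal, ← lift_cof, hcof, Cardinal.lift_lift]
    exact Cardinal.lift_lt.2 (lt_ord.1 ho)
  have hsmall : ∀ o < κ, enumOrd s o < κ := fun o ↦ by
    induction o using WellFoundedLT.induction with
    | ind o ih =>
      intro ho
      obtain ⟨b, hb, hlt⟩ := hD.exists_gt hκ0
        (max_lt ha (hsup o ho fun i hi ↦ ih i hi (lt_trans hi ho)))
      refine (enumOrd_le_of_forall_lt (Or.inl ⟨hb, (le_max_left _ _).trans_lt hlt⟩)
        fun c hc ↦ ?_).trans_lt (hD.1 hb)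
      exact (Ordinal.le_iSup (fun i : Set.Iio o ↦ enumOrd s i) ⟨c, hc⟩).trans_lt
        ((le_max_right _ _).trans_lt hlt)
  have hlκ : lam.ord < κ := ord_lt_ord.2 (Order.lt_succ lam)
  have hlim := isSuccLimit_ord hlam.aleph0_le
  have hmem : ∀ i < lam.ord, enumOrd s i ∈ D ∩ Set.Ioi a := fun i hi ↦
    (enumOrd_mem hsu i).resolve_right fun h ↦ (hsmall i (hi.trans hlκ)).not_ge h
  have hmono := enumOrd_strictMono hsu
  have hle : ∀ i < lam.ord, enumOrd s i < ⨆ i : Set.Iio lam.ord, enumOrd s i := fun i hi ↦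
    (hmono (Order.lt_succ i)).trans_le
      (Ordinal.le_iSup (fun i : Set.Iio lam.ord ↦ enumOrd s i) ⟨_, hlim.succ_lt hi⟩)
  have hbκ := hsup _ hlκ fun i hi ↦ hsmall i (hi.trans hlκ)
  refine ⟨⨆ i : Set.Iio lam.ord, enumOrd s i, ⟨?_, hbκ, ?_⟩, ?_⟩
  · refine (isClubIn_iff.1 hD).2.1 _ hbκ ⟨_, (hmem 0 hlim.bot_lt).1, (hle 0 hlim.bot_lt).le⟩
      fun b hb ↦ ?_
    obtain ⟨i, hi⟩ := Ordinal.lt_iSup_iff.1 hb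
    exact ⟨_, (hmem i i.2).1, hi, (hle i i.2).le⟩
  · rw [cof_iSup_Iio (f := fun i : Set.Iio lam.ord ↦ enumOrd s i)
      (hmono.comp (Subtype.strictMono_coe _)) hlim.isSuccPrelimit, hlam.cof_ord]
  · exact lt_trans (hmem 0 hlim.bot_lt).2 (hle 0 hlim.bot_lt)

theorem nextPoint_spec {A : Set Ordinal.{u}} {β x : Ordinal.{u}} (hx : x ∈ A) (hβx : β < x) :
    nextPoint A β ∈ A ∧ β < nextPoint A β := by
  have h := csInf_mem (s := A \ Set.Iio (β + 1))
    ⟨x, hx, fun h ↦ hβx.not_ge (Order.lt_add_one_iff.1 h)⟩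
  exact ⟨h.1, Order.add_one_le_iff.1 (not_lt.1 h.2)⟩

theorem nextPoint_le {A : Set Ordinal.{u}} {β x : Ordinal.{u}} (hx : x ∈ A) (hβx : β < x) :
    nextPoint A β ≤ x :=
  csInf_le' ⟨hx, fun h ↦ hβx.not_ge (Order.lt_add_one_iff.1 h)⟩

/-! ### Guessing by intervals -/

theorem exists_interval_guessing {lam : Cardinal.{u}} (hlam : lam.IsRegular) (hω : ℵ₀ < lam) :
    ∃ f : Ordinal.{u} → Ordinal.{u} → Ordinal.{u},
      (∀ δ ∈ cofPoints (Order.succ lam) lam, ∀ β < δ, f δ β < δ) ∧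
      ∀ D : Set Ordinal.{u}, IsClubIn D (Order.succ lam).ord →
        ∃ δ ∈ cofPoints (Order.succ lam) lam,
          IsStationaryIn {β | β < δ ∧ ∃ x ∈ D, β < x ∧ x ≤ f δ β} δ := by
  set S := cofPoints (Order.succ lam) lam with hS
  set κ := (Order.succ lam).ord with hκdef
  have hSω : ∀ δ ∈ S, ℵ₀ < δ.cof := fun δ h ↦ h.2.symm ▸ hω
  have hκω : ℵ₀ < κ.cof := by
    rw [hκdef, (isRegular_succ hlam.aleph0_le).cof_ord]
    exact hω.trans (Order.lt_succ lam)
  by_contra! hcon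
  have key : ∀ C : {C : Ordinal.{u} → Set Ordinal.{u} // ∀ δ ∈ S, IsClubIn (C δ) δ},
      ∃ (D : Set Ordinal.{u}) (C' : {C : Ordinal.{u} → Set Ordinal.{u} //
        ∀ δ ∈ S, IsClubIn (C δ) δ}), IsClubIn D κ ∧ ∀ δ ∈ S, C'.1 δ ⊆ C.1 δ ∧
          ∀ β ∈ C'.1 δ, ∀ x ∈ D, β < x → nextPoint (C.1 δ) β < x := by
    rintro ⟨C, hC⟩
    obtain ⟨D, hD, hns⟩ := hcon (fun δ β ↦ nextPoint (C δ) β) fun δ hδ β hβ ↦ by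
      obtain ⟨x, hx, hβx⟩ := (hC δ hδ).exists_gt (hSω δ hδ) hβ
      exact (hC δ hδ).1 (nextPoint_spec hx hβx).1
    have hE := fun δ hδ ↦ exists_isClubIn_of_not_isStationaryIn (fun β hβ ↦ hβ.1) (hns δ hδ)
    choose! E hE hE' using hE
    refine ⟨D, ⟨fun δ ↦ E δ ∩ C δ, fun δ hδ ↦ (hE δ hδ).inter (hSω δ hδ) (hC δ hδ)⟩, hD,
      fun δ hδ ↦ ⟨Set.inter_subset_right, fun β hβ x hx hβx ↦ ?_⟩⟩
    by_contra! hle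
    exact hE' δ hδ β hβ.1 ⟨(hE δ hδ).1 hβ.1, x, hx, hβx, hle⟩
  choose D next hD hnext using key
  -- Starting from clubs that avoid cofinality `lam` keeps each `ζ n` below strictly under `x`.
  have hB : ∀ δ ∈ S, ∃ B, IsClubIn B δ ∧ ∀ b ∈ B, b.cof ≠ lam := fun δ hδ ↦
    let ⟨B, h₁, _, h₂⟩ := exists_isClubIn_smallSegments hω hδ.2
    ⟨B, h₁, h₂⟩
  choose! B hB hBcof using hB
  obtain ⟨C, hC₀, hCs⟩ :
      ∃ C : ℕ → {C : Ordinal.{u} → Set Ordinal.{u} // ∀ δ ∈ S, IsClubIn (C δ) δ},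
        C 0 = ⟨B, hB⟩ ∧ ∀ n, next (C n) = C (n + 1) :=
    ⟨fun n ↦ Nat.rec ⟨B, hB⟩ (fun _ C ↦ next C) n, rfl, fun _ ↦ rfl⟩
  have hstep := fun n ↦ hnext (C n)
  simp only [hCs] at hstep
  have hsub : ∀ n, ∀ δ ∈ S, (C (n + 1)).1 δ ⊆ (C n).1 δ := fun n δ hδ ↦ (hstep n δ hδ).1
  have hCB : ∀ n, ∀ δ ∈ S, (C n).1 δ ⊆ B δ := fun n δ hδ ↦ by
    induction n with
    | zero => rw [hC₀]
    | succ n ih => exact (hsub n δ hδ).trans ih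
  have hDω := IsClubIn.forall_nat_mem hκω fun n ↦ hD (C n)
  have hlimD := isClubIn_limitPoints hκω (A := {β | β < κ ∧ ∀ n, β ∈ D (C n)} ∩ S) fun a ha ↦
    let ⟨b, hb, hab⟩ := exists_mem_cofPoints hlam hDω ha
    ⟨b, hb, hab, hb.1.1⟩
  obtain ⟨δ, ⟨hδ, hδS⟩, -⟩ := exists_mem_cofPoints hlam hlimD
    (isSuccLimit_of_aleph0_lt_cof hκω).bot_lt
  obtain ⟨p, ⟨hpδ, hp⟩, -⟩ := (IsClubIn.forall_nat_mem (hSω δ hδS)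
    fun n ↦ (C n).2 δ hδS).exists_gt (hSω δ hδS) (isSuccLimit_of_aleph0_lt_cof (hSω δ hδS)).bot_lt
  obtain ⟨x, ⟨hxD, hxS⟩, hpx, hxδ⟩ := hδ.2 p hpδ
  let ζ : ℕ → Ordinal.{u} := fun n ↦ sSup ((C n).1 δ ∩ Set.Iic x)
  have hζmem : ∀ n, ζ n ∈ (C n).1 δ := fun n ↦ ((C n).2 δ hδS).sSup_mem hxδ (hp n) hpx.le
  have hζle : ∀ n, ζ n ≤ x := fun n ↦ csSup_le ⟨p, hp n, hpx.le⟩ fun y hy ↦ hy.2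
  have hle : ∀ n, ∀ y ∈ (C n).1 δ, y ≤ x → y ≤ ζ n := fun n y hy hyx ↦
    le_csSup ⟨x, fun z hz ↦ hz.2⟩ ⟨hy, hyx⟩
  obtain ⟨_, ⟨n, rfl⟩, hmin⟩ : ∃ z ∈ Set.range ζ, ∀ y ∈ Set.range ζ, z ≤ y :=
    ⟨_, csInf_mem (Set.range_nonempty ζ), fun y hy ↦ csInf_le' hy⟩
  have hn : ζ n = ζ (n + 1) := (hmin _ ⟨n + 1, rfl⟩).antisymm
    (hle n _ (hsub n δ hδS (hζmem (n + 1))) (hζle _))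
  have hζx : ζ n < x := (hζle n).lt_of_ne fun h ↦
    hBcof δ hδS _ (hCB n δ hδS (hζmem n)) (h ▸ hxS.2)
  have hlt := (hstep n δ hδS).2 (ζ n) (hn ▸ hζmem (n + 1)) x (hxD.2 n) hζx
  obtain ⟨y, hy, hxy⟩ := ((C n).2 δ hδS).exists_gt (hSω δ hδS) hxδ
  obtain ⟨h₁, h₂⟩ := nextPoint_spec hy (hζx.trans hxy)
  exact h₂.not_ge (hle n _ h₁ hlt.le)

/-! ### From intervals to points -/

/-- If no single function guesses, then for fewer than `lam` functions
one club witnesses this simultaneously. -/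
theorem exists_isClubIn_forall_notMem {lam : Cardinal.{u}} (hlam : lam.IsRegular) (hω : ℵ₀ < lam)
    (hcon : ∀ f : Ordinal.{u} → Ordinal.{u} → Ordinal.{u},
      (∀ δ ∈ cofPoints (Order.succ lam) lam, ∀ β < δ, β < f δ β ∧ f δ β < δ) →
      ∃ D : Set Ordinal.{u}, IsClubIn D (Order.succ lam).ord ∧
        ∀ δ ∈ cofPoints (Order.succ lam) lam,
          ¬ IsStationaryIn {β | β < δ ∧ f δ β ∈ D ∩ cofPoints (Order.succ lam) lam} δ)
    {ι : Type u} (hι : #ι < lam) (f : ι → Ordinal.{u} → Ordinal.{u} → Ordinal.{u}) :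
    ∃ D : Set Ordinal.{u}, IsClubIn D (Order.succ lam).ord ∧
      ∀ δ ∈ cofPoints (Order.succ lam) lam, ∃ E, IsClubIn E δ ∧
        ∀ β ∈ E, ∀ i, β < f i δ β → f i δ β < δ →
          f i δ β ∉ D ∩ cofPoints (Order.succ lam) lam := by
  set S := cofPoints (Order.succ lam) lam with hS
  set κ := (Order.succ lam).ord with hκdef
  have hκc : κ.cof = Order.succ lam := (isRegular_succ hlam.aleph0_le).cof_ord
  have hκω : ℵ₀ < κ.cof := hκc ▸ hω.trans (Order.lt_succ lam)
  have hSω : ∀ δ ∈ S, ℵ₀ < δ.cof := fun δ h ↦ h.2.symm ▸ hω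
  classical
  have hD := fun i ↦ hcon
    -- The default `Order.succ β` only makes the function admissible for `hcon`.
    (fun δ β ↦ if β < f i δ β ∧ f i δ β < δ then f i δ β else Order.succ β) fun δ hδ β hβ ↦ by
      split_ifs with h
      · exact h
      · exact ⟨Order.lt_succ β, (isSuccLimit_of_aleph0_lt_cof (hSω δ hδ)).succ_lt hβ⟩
  choose D hD hns using hD
  have hE := fun i δ hδ ↦ exists_isClubIn_of_not_isStationaryIn (fun β hβ ↦ hβ.1) (hns i δ hδ)
  choose! E hE hE' using hE
  refine ⟨_, IsClubIn.forall_mem hκω (hκc ▸ hι.trans (Order.lt_succ lam)) hD, fun δ hδ ↦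
    ⟨_, IsClubIn.forall_mem (hSω δ hδ) (hδ.2.symm ▸ hι) fun i ↦ hE i δ hδ,
      fun β hβ i h₁ h₂ hmem ↦ hE' i δ hδ β (hβ.2 i) ⟨hβ.1, ?_⟩⟩⟩
  rw [if_pos ⟨h₁, h₂⟩]
  exact ⟨hmem.1.2 i, hmem.2⟩

/-- One index set serves all ordinals of small cofinality, so filling in cofinal sets keeps a family
of functions at size `ν`. -/
theorem exists_cofinal_family (ι : Type u) :
    ∃ c : Ordinal.{u} → ι → Ordinal.{u},
      ∀ τ, τ.cof ≤ #ι → ∀ x < τ, ∃ i, x ≤ c τ i ∧ c τ i < τ := by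
  have : ∀ τ : Ordinal.{u}, ∃ c : ι → Ordinal.{u},
      τ.cof ≤ #ι → ∀ x < τ, ∃ i, x ≤ c i ∧ c i < τ := fun τ ↦ by
    by_cases h : τ.cof ≤ #ι ∧ 0 < τ
    · obtain ⟨f, hf⟩ := exists_isFundamentalSeq (o := τ) rfl
      have hne : Nonempty (Set.Iio τ.cof.ord) :=
        ⟨⟨0, by simpa [Set.mem_Iio, pos_iff_ne_zero] using h.2.ne'⟩⟩
      have hcard : Cardinal.lift.{u} #(Set.Iio τ.cof.ord) ≤ Cardinal.lift.{u + 1} #ι := by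
        rw [Cardinal.mk_Iio_ordinal, card_ord, Cardinal.lift_lift]
        exact Cardinal.lift_le.2 h.1
      obtain ⟨g⟩ := Cardinal.lift_mk_le'.1 hcard
      refine ⟨fun k ↦ f (Function.invFun g k), fun _ x hx ↦ ?_⟩
      obtain ⟨_, ⟨j, rfl⟩, hj⟩ := hf.isCofinal_range ⟨x, hx⟩
      refine ⟨g j, ?_, (f _).2⟩
      simp only [Function.leftInverse_invFun g.injective j]
      exact hj
    · exact ⟨fun _ ↦ 0, fun h₁ x hx ↦ absurd ⟨h₁, pos_of_gt hx⟩ h⟩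
  choose c hc using this
  exact ⟨c, hc⟩

theorem exists_point_guessing {ν lam : Cardinal.{u}} (hν : ℵ₀ ≤ ν) (hlν : lam = Order.succ ν) :
    ∃ f : Ordinal.{u} → Ordinal.{u} → Ordinal.{u},
      (∀ δ ∈ cofPoints (Order.succ lam) lam, ∀ β < δ, β < f δ β ∧ f δ β < δ) ∧
      ∀ D : Set Ordinal.{u}, IsClubIn D (Order.succ lam).ord →
        ∃ δ ∈ cofPoints (Order.succ lam) lam,
          IsStationaryIn {β | β < δ ∧ f δ β ∈ D ∩ cofPoints (Order.succ lam) lam} δ := by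
  have hνl : ν < lam := hlν ▸ Order.lt_succ ν
  have hω : ℵ₀ < lam := hν.trans_lt hνl
  have hlam : lam.IsRegular := hlν ▸ isRegular_succ hν
  obtain ⟨g, hg, hguess⟩ := exists_interval_guessing hlam hω
  obtain ⟨c, hc⟩ := exists_cofinal_family ν.out
  rw [mk_out] at hc
  set S := cofPoints (Order.succ lam) lam with hS
  set κ := (Order.succ lam).ord with hκdef
  have hSω : ∀ δ ∈ S, ℵ₀ < δ.cof := fun δ h ↦ h.2.symm ▸ hω
  have hκω : ℵ₀ < κ.cof := by
    rw [hκdef, (isRegular_succ hlam.aleph0_le).cof_ord]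
    exact hω.trans (Order.lt_succ lam)
  by_contra! hcon
  choose D hD hE using fun f : ν.out → Ordinal.{u} → Ordinal.{u} → Ordinal.{u} ↦
    exists_isClubIn_forall_notMem hlam hω hcon (by simpa using hνl) f
  obtain ⟨e⟩ : Nonempty (ν.out ≃ ν.out ⊕ ν.out ⊕ ν.out × ν.out) :=
    Cardinal.eq.1 (by simp [Cardinal.mul_eq_self hν, Cardinal.add_eq_self hν])
  let F : ℕ → ν.out → Ordinal.{u} → Ordinal.{u} → Ordinal.{u} := fun n ↦
    Nat.rec (fun _ ↦ g) (fun _ f k δ β ↦ match e k with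
      | .inl j => f j δ β
      | .inr (.inl j) => sSup (D f ∩ Set.Iic (f j δ β))
      | .inr (.inr (j, i)) => c (f j δ β) i) n
  have hdrop : ∀ n j, ∃ k, ∀ δ β, F (n + 1) k δ β = sSup (D (F n) ∩ Set.Iic (F n j δ β)) :=
    fun n j ↦ ⟨e.symm (.inr (.inl j)), fun δ β ↦ by simp [F]⟩
  have hfill : ∀ n j i, ∃ k, ∀ δ β, F (n + 1) k δ β = c (F n j δ β) i :=
    fun n j i ↦ ⟨e.symm (.inr (.inr (j, i))), fun δ β ↦ by simp [F]⟩
  have hDω := IsClubIn.forall_nat_mem hκω fun n ↦ hD (F n)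
  have hlimD := isClubIn_limitPoints hκω (A := {β | β < κ ∧ ∀ n, β ∈ D (F n)} ∩ S) fun a ha ↦
    let ⟨b, hb, hab⟩ := exists_mem_cofPoints hlam hDω ha
    ⟨b, hb, hab, hb.1.1⟩
  obtain ⟨δ, hδ, hst⟩ := hguess _ hlimD
  choose E hE hE' using fun n ↦ hE (F n) δ hδ
  obtain ⟨β, ⟨hβδ, x, hx, hβx, hxg⟩, -, hβE⟩ :=
    hst.exists_mem (IsClubIn.forall_nat_mem (hSω δ hδ) hE)
  -- Values whose interval above `β` still catches a point of `S` lying in all the clubs.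
  let T : Set Ordinal.{u} := {τ | (∃ n k, F n k δ β = τ) ∧
    ∃ y ∈ {β | β < κ ∧ ∀ n, β ∈ D (F n)} ∩ S, β < y ∧ y ≤ τ}
  obtain ⟨k₀⟩ : Nonempty ν.out := by
    rw [← mk_ne_zero_iff, mk_out]
    exact (aleph0_pos.trans_le hν).ne'
  have hgT : g δ β ∈ T := by
    obtain ⟨y, hy, hβy, hyx⟩ := hx.2 β hβx
    exact ⟨⟨0, k₀, rfl⟩, y, hy, hβy, hyx.le.trans hxg⟩
  obtain ⟨τ, ⟨⟨n, k, hnk⟩, y, hy, hβy, hyτ⟩, hmin⟩ : ∃ τ ∈ T, ∀ σ ∈ T, τ ≤ σ :=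
    ⟨sInf T, csInf_mem ⟨_, hgT⟩, fun σ hσ ↦ csInf_le' hσ⟩
  have hτδ : τ < δ := (hmin _ hgT).trans_lt (hg δ hδ β hβδ)
  have hτκ : τ < κ := hτδ.trans hδ.1
  have hτD : τ ∈ D (F n) := by
    -- Dropping keeps `y` in the interval, so by minimality it does not move `τ`.
    obtain ⟨j, hj⟩ := hdrop n k
    have hj := hj δ β
    rw [hnk] at hj
    have hle : τ ≤ sSup (D (F n) ∩ Set.Iic τ) := hmin _ ⟨⟨n + 1, j, hj⟩, y, hy, hβy,
      le_csSup ⟨τ, fun z hz ↦ hz.2⟩ ⟨hy.1.2 n, hyτ⟩⟩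
    have hge : sSup (D (F n) ∩ Set.Iic τ) ≤ τ :=
      csSup_le ⟨y, hy.1.2 n, hyτ⟩ fun z hz ↦ hz.2
    have := (hD (F n)).sSup_mem hτκ (hy.1.2 n) hyτ
    rwa [hge.antisymm hle] at this
  by_cases hcof : τ.cof = lam
  · have := hE' n β (hβE n) k
    rw [hnk] at this
    exact this (hβy.trans_le hyτ) hτδ ⟨hτD, hτκ, hcof⟩
  · have hτν : τ.cof ≤ ν := by
      have h₁ : τ.cof ≤ lam := (cof_le_card τ).trans (Order.lt_succ_iff.1 (lt_ord.1 hτκ))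
      rw [← Order.lt_succ_iff, ← hlν]
      exact h₁.lt_of_ne hcof
    -- Filling then yields a value in `[y, τ)`, against minimality.
    have hyτ' : y < τ := hyτ.lt_of_ne fun h ↦ hcof (h ▸ hy.2.2)
    obtain ⟨i, hyi, hi⟩ := hc τ hτν y hyτ'
    obtain ⟨j, hj⟩ := hfill n k i
    have hj := hj δ β
    rw [hnk] at hj
    exact hi.not_ge (hmin _ ⟨⟨n + 1, j, hj⟩, y, hy, hβy, hyi⟩)

/-! ### From a guessing function to a `C`-sequence -/

theorem typeLT_le_of_smallSegments {lam : Cardinal.{u}} {C : Set Ordinal.{u}} {δ : Ordinal.{u}}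
    (hC : C ⊆ Set.Iio δ) (hs : HasSmallSegments lam C δ) :
    typeLT C ≤ Ordinal.lift.{u + 1} lam.ord := by
  by_contra! hlt
  obtain ⟨x, hx⟩ := typein_surj (α := C) (· < ·) hlt
  have hcard : #(Set.Iio x) = Cardinal.lift.{u + 1} lam := by
    have := congrArg Ordinal.card hx
    rw [card_typein, Cardinal.lift_ord, card_ord] at this
    exact this
  have hle : #(Set.Iio x) ≤ #↥(C ∩ Set.Iio x.1) :=
    mk_le_of_injective (f := fun y ↦ ⟨y.1.1, y.1.2, y.2⟩) fun y z h ↦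
      Subtype.ext (Subtype.ext (Subtype.mk.inj h))
  exact (hs x.1 (hC x.2)).not_ge (hcard ▸ hle)

/-- Thin out to the points `E` closed under `f` and add `f '' E`: each `f β` lands before the next
point of `E`. -/
theorem exists_isClubIn_nextPoint_eq {lam : Cardinal.{u}} {δ : Ordinal.{u}}
    (hlam : ℵ₀ < lam) (hδ : δ.cof = lam) {f : Ordinal.{u} → Ordinal.{u}}
    (hf : ∀ β < δ, β < f β ∧ f β < δ) :
    ∃ C, IsClubIn C δ ∧ HasSmallSegments lam C δ ∧
      ∃ E, IsClubIn E δ ∧ ∀ β ∈ E, nextPoint C β = f β := by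
  obtain ⟨B, hB, hs, -⟩ := exists_isClubIn_smallSegments hlam hδ
  have hE := isClubIn_closurePoints hlam hδ hB hs fun b hb ↦ (hf b hb).2
  set E := {a | a ∈ B ∧ ∀ b ∈ B, b < a → f b < a} with hEdef
  have hlt : ∀ a ∈ E, ∀ b ∈ E, b < a → f b < a := fun a ha b hb ↦ ha.2 b hb.1
  have hfE : ∀ b ∈ E, b < f b := fun b hb ↦ (hf b (hE.1 hb)).1
  refine ⟨E ∪ f '' E, isClubIn_iff.2 ⟨?_, fun a ha ⟨c₀, hc₀, hca₀⟩ hP ↦ ?_, fun a ha ↦ ?_⟩,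
    fun b hb ↦ ?_, E, hE, fun β hβ ↦ le_antisymm (nextPoint_le (Or.inr ⟨β, hβ, rfl⟩) (hfE β hβ)) ?_⟩
  · rintro _ (h | ⟨x, hx, rfl⟩)
    · exact hE.1 h
    · exact (hf x (hE.1 hx)).2
  · by_contra haC
    have hP' : ∀ b < a, ∃ c ∈ E ∪ f '' E, b < c ∧ c < a := fun b hb ↦ by
      obtain ⟨c, hc, hbc, hca⟩ := hP b hb
      exact ⟨c, hc, hbc, hca.lt_of_ne fun h ↦ haC (h ▸ hc)⟩
    -- Between two points `f d < f e` of `f '' E` lies `e ∈ E`, so a limit of the union is a limit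
    -- of `E`.
    have hPE : ∀ b < a, ∃ c ∈ E, b < c ∧ c ≤ a := fun b hb ↦ by
      obtain ⟨x, hx, hbx, hxa⟩ := hP' b hb
      obtain ⟨y, hy, hxy, hya⟩ := hP' x hxa
      rcases hx with hx | ⟨d, hd, rfl⟩
      · exact ⟨x, hx, hbx, hxa.le⟩
      rcases hy with hy | ⟨e, he, rfl⟩
      · exact ⟨y, hy, hbx.trans hxy, hya.le⟩
      have hde : d < e := by
        by_contra! h
        rcases h.eq_or_lt with rfl | h
        · exact hxy.false
        · exact (hxy.trans ((hlt d hd e he h).trans (hfE d hd))).false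
      exact ⟨e, he, hbx.trans (hlt e he d hd hde), ((hfE e he).trans hya).le⟩
    obtain ⟨c, hc, -, hca⟩ := hPE c₀ (hca₀.lt_of_ne fun h ↦ haC (h ▸ hc₀))
    exact haC (Or.inl ((isClubIn_iff.1 hE).2.1 a ha ⟨c, hc, hca⟩ hPE))
  · obtain ⟨b, hb, hab⟩ := (isClubIn_iff.1 hE).2.2 a ha
    exact ⟨b, Or.inl hb, hab⟩
  · have hsub : (E ∪ f '' E) ∩ Set.Iio b ⊆ (B ∩ Set.Iio b) ∪ f '' (B ∩ Set.Iio b) := by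
      rintro _ ⟨h | ⟨x, hx, rfl⟩, hxb⟩
      · exact Or.inl ⟨h.1, hxb⟩
      · exact Or.inr ⟨x, ⟨hx.1, (hfE x hx).trans hxb⟩, rfl⟩
    refine (mk_le_mk_of_subset hsub).trans_lt ((mk_union_le _ _).trans_lt ?_)
    exact add_lt_of_lt (by simpa using hlam.le) (hs b hb) (mk_image_le.trans_lt (hs b hb))
  · obtain ⟨h₁, h₂⟩ := nextPoint_spec (A := E ∪ f '' E) (Or.inr ⟨β, hβ, rfl⟩) (hfE β hβ)
    rcases h₁ with h | ⟨d, hd, hde⟩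
    · exact (hlt _ h β hβ h₂).le
    · rw [← hde] at h₂ ⊢
      rcases lt_trichotomy d β with h | rfl | h
      · exact absurd (hlt β hβ d hd h) h₂.not_gt
      · exact le_rfl
      · exact ((hlt d hd β hβ h).trans (hfE d hd)).le

theorem sSup_eq_of_isClubIn {C : Set Ordinal.{u}} {δ : Ordinal.{u}} (hC : IsClubIn C δ) :
    sSup C = sSup (Set.Iio δ) := by
  have hbd : BddAbove (Set.Iio δ) := ⟨δ, fun x hx ↦ le_of_lt hx⟩
  refine le_antisymm (csSup_le_csSup' hbd hC.1) (csSup_le' fun x hx ↦ ?_)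
  obtain ⟨y, hy, hxy⟩ := (isClubIn_iff.1 hC).2.2 x hx
  exact hxy.trans (le_csSup (hbd.mono hC.1) hy)

theorem theoremA (lam : Cardinal.{u}) (hlam : ∃ ν : Cardinal.{u}, ℵ₀ ≤ ν ∧ lam = Order.succ ν) :
    ∃ C : Ordinal.{u} → Set Ordinal.{u},
      IsCSequence (cofPoints (Order.succ lam) lam) C ∧
      IsBoundedSeq lam.ord (cofPoints (Order.succ lam) lam) C ∧
      ∀ D : Set Ordinal.{u}, IsClubIn D (Order.succ lam).ord →
        ∃ δ ∈ cofPoints (Order.succ lam) lam,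
          IsStationaryIn
            {β | β < δ ∧ nextPoint (C δ) β ∈ D ∩ cofPoints (Order.succ lam) lam} δ := by
  obtain ⟨ν, hν, hlν⟩ := hlam
  have hω : ℵ₀ < lam := hlν ▸ hν.trans_lt (Order.lt_succ ν)
  obtain ⟨f, hf, hguess⟩ := exists_point_guessing hν hlν
  choose! C hC hs E hE hEf using fun δ (hδ : δ ∈ cofPoints (Order.succ lam) lam) ↦
    exists_isClubIn_nextPoint_eq hω hδ.2 (hf δ hδ)
  refine ⟨C, ⟨fun δ hδ ↦ (hC δ hδ).1, fun δ hδ ↦ (hC δ hδ).2.dirSupClosed,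
    fun δ hδ ↦ sSup_eq_of_isClubIn (hC δ hδ)⟩,
    fun δ hδ ↦ typeLT_le_of_smallSegments (hC δ hδ).1 (hs δ hδ), fun D hD ↦ ?_⟩
  obtain ⟨δ, hδ, hst⟩ := hguess D hD
  refine ⟨δ, hδ, isStationaryIn_of_forall (fun β hβ ↦ hβ.1) fun G hG ↦ ?_⟩
  obtain ⟨β, ⟨hβδ, hβ⟩, hβG, hβE⟩ :=
    hst.exists_mem (hG.inter (hδ.2.symm ▸ hω) (hE δ hδ))
  exact ⟨β, ⟨hβδ, by rwa [hEf δ hδ β hβE]⟩, hβG⟩
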